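/- All digraphs are finite; between two distinct vertices there is at most one edge in each direction, while loops, possibly several at a vertex, are allowed. A \emph{multipath} of a digraph $G$ is a spanning subgraph each of whose connected components is a single vertex or a simple directed path (a path that is not a cycle and visits no vertex twice); it is identified with its set of edges. A digraph $G$ is an \emph{MP-digraph} if (MP1) neither $G$ nor the digraph obtained from $G$ by reversing all edges contains as a subgraph the triangle with edges $(v_1,v_0),(v_0,v_2),(v_1,v_2)$ or the alternating digraph on four distinct vertices with edges $(v_0,v_1),(v_2,v_1),(v_2,v_3)$, and (MP2) every coherently oriented cycle of length at least two in $G$ is a connected component of $G$. If $G$ is an MP-digraph, the multipaths of $G$ are the independent sets of a matroid $M_G$ with ground set $E(G)$, the \emph{multipath matroid}; write $r(G)$ for its rank and $$T_{M_G}(x,y)=\sum_{A\subseteq E(G)}(x-1)^{r_{M_G}(E(G))-r_{M_G}(A)}(y-1)^{|A|-r_{M_G}(A)}$$ for its Tutte polynomial. Spanning subgraphs of MP-digraphs are MP-digraphs. For $k\in\mathbb{N}$, a \emph{flowing $k$-colouring} of a digraph $H$ is a map $c\colon V(H)\to\{1,\dots,k\}$ such that $c(v)\neq c(w)$ for every edge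 $(v,w)$, $c(v)=c(v')$ whenever $(v,w)$ and $(v',w)$ are edges, and $c(v)=c(v')$ whenever $(w,v)$ and $(w,v')$ are edges; $\tau_H(k)$ denotes the number of flowing $k$-colourings of $H$. \textbf{Theorem.} Let $G$ be a (nonempty) connected loopless MP-digraph that is not a coherently oriented cycle. Then, for every spanning tree $S$ of $G$ (a spanning subgraph whose underlying undirected multigraph is a tree) with $r(S)=r(G)$, the relation $$k\,T_{M_G}(1-k,0)=(-1)^{r(G)}\,\tau_S(k)$$ holds for all integers $k\geq 0$. -/

import Mathlib

open Function Set

/-- A digraph with vertex type `V` and edge type `E`: every edge has a source and a target, between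
two distinct vertices there is at most one edge in each direction, and there may be any number of
loops at a vertex. -/
structure EDigraph (V E : Type*) where
  src : E → V
  tgt : E → V
  eq_of_ends : ∀ e f : E, src e ≠ tgt e → src e = src f → tgt e = tgt f → e = f

namespace EDigraph

variable {V E : Type*}

/-- `(v, w)` is an edge. -/
def Adj (G : EDigraph V E) (v w : V) : Prop := ∃ e, G.src e = v ∧ G.tgt e = w

/-- There are no edges with equal source and target. -/
def Loopless (G : EDigraph V E) : Prop := ∀ e, G.src e ≠ G.tgt e

/-- The digraph with all edges reversed. -/
def reverse (G : EDigraph V E) : EDigraph V E where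
  src := G.tgt
  tgt := G.src
  eq_of_ends e f h h₁ h₂ := G.eq_of_ends e f h.symm h₂ h₁

/-- The spanning subgraph (all vertices are kept) with edge set `A`. -/
def spanning (G : EDigraph V E) (A : Set E) : EDigraph V A where
  src e := G.src e
  tgt e := G.tgt e
  eq_of_ends e f h h₁ h₂ := Subtype.ext (G.eq_of_ends e f h h₁ h₂)

/-- The simple graph on `V` in which two distinct vertices are adjacent if some edge (in either
direction) joins them. Its connected components are those of the digraph. -/
def underlying (G : EDigraph V E) : SimpleGraph V := SimpleGraph.fromRel G.Adj

/-- `v` and `w` lie in the same connected component. -/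
def Joined (G : EDigraph V E) (v w : V) : Prop := G.underlying.Reachable v w

/-- The digraph is nonempty and connected. -/
def Connected (G : EDigraph V E) : Prop := G.underlying.Connected

/-- The underlying undirected multigraph is a tree: it has no loops and no two edges with the same
ends, and as a simple graph it is a tree. -/
def IsTree (G : EDigraph V E) : Prop :=
  G.Loopless ∧ Injective (fun e => s(G.src e, G.tgt e)) ∧ G.underlying.IsTree

/-- `x 0, …, x n` are distinct vertices, and `p i` is an edge from `x i` to `x (i + 1)`, for
`i < n`. (For `n = 0` this is a single vertex.) -/
def IsSimplePath (G : EDigraph V E) {n : ℕ} (x : Fin (n + 1) → V) (p : Fin n → E) : Prop :=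
  Injective x ∧ ∀ i, G.src (p i) = x i.castSucc ∧ G.tgt (p i) = x i.succ

/-- `x 0, …, x n` are distinct vertices, and `c i` is an edge from `x i` to `x (i + 1)`, where the
indices are read modulo `n + 1`. (For `n = 0` this is a loop.) -/
def IsOrientedCycle (G : EDigraph V E) {n : ℕ} (x : Fin (n + 1) → V) (c : Fin (n + 1) → E) :
    Prop :=
  Injective x ∧ ∀ i, G.src (c i) = x i ∧ G.tgt (c i) = x (i + 1)

/-- The whole digraph is a coherently oriented cycle. -/
def IsCoherentlyOrientedCycle (G : EDigraph V E) : Prop :=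
  ∃ (n : ℕ) (x : Fin (n + 1) → V) (c : Fin (n + 1) → E),
    G.IsOrientedCycle x c ∧ range x = univ ∧ range c = univ

/-- A set `A` of edges is (the edge set of) a multipath: each connected component of the spanning
subgraph with edge set `A` is a vertex or a simple path. -/
def IsMultipath (G : EDigraph V E) (A : Set E) : Prop :=
  ∀ v : V, ∃ (n : ℕ) (x : Fin (n + 1) → V) (p : Fin n → A), (G.spanning A).IsSimplePath x p ∧
    range x = {w | (G.spanning A).Joined v w} ∧
    range p = {e | (G.spanning A).Joined v ((G.spanning A).src e)}

/-- `G` contains the triangle with edges `(v₁, v₀)`, `(v₀, v₂)`, `(v₁, v₂)`. -/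
def ContainsTriangle (G : EDigraph V E) : Prop :=
  ∃ x : Fin 3 → V, Injective x ∧ G.Adj (x 1) (x 0) ∧ G.Adj (x 0) (x 2) ∧ G.Adj (x 1) (x 2)

/-- `G` contains the alternating linear digraph with edges `(v₀, v₁)`, `(v₂, v₁)`, `(v₂, v₃)`. -/
def ContainsAlternating (G : EDigraph V E) : Prop :=
  ∃ x : Fin 4 → V, Injective x ∧ G.Adj (x 0) (x 1) ∧ G.Adj (x 2) (x 1) ∧ G.Adj (x 2) (x 3)

/-- MP-digraphs: none of the two forbidden digraphs is contained in `G` or in its reverse, and every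
coherently oriented cycle of length at least two is a connected component. -/
structure IsMP (G : EDigraph V E) : Prop where
  no_triangle : ¬ G.ContainsTriangle ∧ ¬ G.reverse.ContainsTriangle
  no_alternating : ¬ G.ContainsAlternating ∧ ¬ G.reverse.ContainsAlternating
  cycle_component : ∀ (n : ℕ) (x : Fin (n + 1) → V) (c : Fin (n + 1) → E), 1 ≤ n →
    G.IsOrientedCycle x c →
      range x = {w | G.Joined (x 0) w} ∧ range c = {e | G.Joined (x 0) (G.src e)}

/-- Flowing colourings. -/
def IsFlowing (G : EDigraph V E) {κ : Type*} (c : V → κ) : Prop :=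
  (∀ e, c (G.src e) ≠ c (G.tgt e)) ∧
  (∀ e f, G.tgt e = G.tgt f → c (G.src e) = c (G.src f)) ∧
  (∀ e f, G.src e = G.src f → c (G.tgt e) = c (G.tgt f))

/-- The number of flowing `k`-colourings. -/
noncomputable def numFlowing (G : EDigraph V E) (k : ℕ) : ℕ :=
  Nat.card {c : V → Fin k // G.IsFlowing c}

/-! The multipaths of a finite MP-digraph are the independent sets of a matroid. -/

theorem joined_src_tgt (G : EDigraph V E) (e : E) : G.Joined (G.src e) (G.tgt e) := by
  by_cases h : G.src e = G.tgt e
  · rw [h]; exact SimpleGraph.Reachable.refl _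
  · exact SimpleGraph.Adj.reachable
      ((SimpleGraph.fromRel_adj _ _ _).2 ⟨h, Or.inl ⟨e, rfl, rfl⟩⟩)

theorem spanning_joined (G : EDigraph V E) {A : Set E} {v w : V}
    (h : (G.spanning A).Joined v w) : G.Joined v w := by
  refine SimpleGraph.Reachable.mono ?_ h
  intro a b hab
  obtain ⟨hne, h⟩ := (SimpleGraph.fromRel_adj _ _ _).1 hab
  refine (SimpleGraph.fromRel_adj _ _ _).2 ⟨hne, h.imp ?_ ?_⟩ <;>
  · rintro ⟨e, h₁, h₂⟩
    exact ⟨e, h₁, h₂⟩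

theorem spanning_adj (G : EDigraph V E) {A : Set E} {v w : V}
    (h : (G.spanning A).Adj v w) : G.Adj v w := by
  obtain ⟨e, h₁, h₂⟩ := h
  exact ⟨e, h₁, h₂⟩

theorem IsMP.spanning {G : EDigraph V E} (hG : G.IsMP) (A : Set E) : (G.spanning A).IsMP where
  no_triangle := by
    refine ⟨fun ⟨x, hx, h₁, h₂, h₃⟩ => hG.no_triangle.1 ⟨x, hx, G.spanning_adj h₁,
      G.spanning_adj h₂, G.spanning_adj h₃⟩, fun ⟨x, hx, h₁, h₂, h₃⟩ => hG.no_triangle.2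
      ⟨x, hx, G.reverse.spanning_adj (A := A) h₁, G.reverse.spanning_adj (A := A) h₂,
      G.reverse.spanning_adj (A := A) h₃⟩⟩
  no_alternating := by
    refine ⟨fun ⟨x, hx, h₁, h₂, h₃⟩ => hG.no_alternating.1 ⟨x, hx, G.spanning_adj h₁,
      G.spanning_adj h₂, G.spanning_adj h₃⟩, fun ⟨x, hx, h₁, h₂, h₃⟩ => hG.no_alternating.2
      ⟨x, hx, G.reverse.spanning_adj (A := A) h₁, G.reverse.spanning_adj (A := A) h₂,
      G.reverse.spanning_adj (A := A) h₃⟩⟩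
  cycle_component := by
    intro n x c hn hc
    obtain ⟨h₁, h₂⟩ := hG.cycle_component n x (fun i => (c i : E)) hn ⟨hc.1, hc.2⟩
    have key : ∀ i, (G.spanning A).Joined (x 0) (x i) := by
      intro i
      induction i using Fin.induction with
      | zero => exact SimpleGraph.Reachable.refl _
      | succ i ih =>
        refine SimpleGraph.Reachable.trans ih ?_
        have := (G.spanning A).joined_src_tgt (c i.castSucc)
        rwa [(hc.2 _).1, (hc.2 _).2, Fin.coeSucc_eq_succ] at this
    constructor
    · ext w
      constructor
      · rintro ⟨i, rfl⟩; exact key i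
      · intro hw
        rw [h₁]; exact G.spanning_joined hw
    · ext e
      constructor
      · rintro ⟨i, rfl⟩
        change (G.spanning A).Joined _ _
        rw [(hc.2 i).1]; exact key i
      · intro he
        have : (e : E) ∈ range (fun i => (c i : E)) := by
          rw [h₂]; exact G.spanning_joined he
        obtain ⟨i, hi⟩ := this
        exact ⟨i, Subtype.ext hi⟩

/-- Multipaths are the edge sets without two edges with a common source or a common target, and
without oriented cycles. -/
theorem isMultipath_iff [Finite V] (G : EDigraph V E) (A : Set E) :
    G.IsMultipath A ↔ InjOn G.src A ∧ InjOn G.tgt A ∧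
      ∀ (n : ℕ) (x : Fin (n + 1) → V) (c : Fin (n + 1) → E), G.IsOrientedCycle x c →
        ¬ range c ⊆ A := by
  constructor
  · intro h
    refine ⟨?_, ?_, ?_⟩
    · intro e he f hf hef
      obtain ⟨n, x, p, hp, -, h₂⟩ := h (G.src e)
      have h₂e : (⟨e, he⟩ : A) ∈ range p := by
        rw [h₂]; exact SimpleGraph.Reachable.refl _
      have h₂f : (⟨f, hf⟩ : A) ∈ range p := by
        rw [h₂]; change (G.spanning A).Joined (G.src e) (G.src f)
        rw [hef]; exact SimpleGraph.Reachable.refl _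
      obtain ⟨i, hi⟩ := h₂e
      obtain ⟨j, hj⟩ := h₂f
      have h₃ : x i.castSucc = x j.castSucc := by
        rw [← (hp.2 i).1, ← (hp.2 j).1, hi, hj]; exact hef
      have h₄ : i = j := Fin.castSucc_injective _ (hp.1 h₃)
      subst h₄
      exact congrArg Subtype.val (hi.symm.trans hj)
    · intro e he f hf hef
      obtain ⟨n, x, p, hp, -, h₂⟩ := h (G.src e)
      have h₂e : (⟨e, he⟩ : A) ∈ range p := by
        rw [h₂]; exact SimpleGraph.Reachable.refl _
      have h₂f : (⟨f, hf⟩ : A) ∈ range p := by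
        rw [h₂]
        have h₅ := (G.spanning A).joined_src_tgt ⟨e, he⟩
        have h₆ := ((G.spanning A).joined_src_tgt ⟨f, hf⟩).symm
        refine SimpleGraph.Reachable.trans h₅ ?_
        have : (G.spanning A).tgt ⟨e, he⟩ = (G.spanning A).tgt ⟨f, hf⟩ := hef
        rw [this]; exact h₆
      obtain ⟨i, hi⟩ := h₂e
      obtain ⟨j, hj⟩ := h₂f
      have h₃ : x i.succ = x j.succ := by
        rw [← (hp.2 i).2, ← (hp.2 j).2, hi, hj]; exact hef
      have h₄ : i = j := Fin.succ_injective _ (hp.1 h₃)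
      subst h₄
      exact congrArg Subtype.val (hi.symm.trans hj)
    · intro n y c hc hcA
      obtain ⟨m, x, p, hp, -, h₂⟩ := h (y 0)
      let c' : Fin (n + 1) → A := fun i => ⟨c i, hcA ⟨i, rfl⟩⟩
      have key : ∀ i, (G.spanning A).Joined (y 0) (y i) := by
        intro i
        induction i using Fin.induction with
        | zero => exact SimpleGraph.Reachable.refl _
        | succ i ih =>
          refine SimpleGraph.Reachable.trans ih ?_
          have h₃ : (G.spanning A).Joined (G.src (c i.castSucc)) (G.tgt (c i.castSucc)) :=
            (G.spanning A).joined_src_tgt (c' i.castSucc)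
          rwa [(hc.2 _).1, (hc.2 _).2, Fin.coeSucc_eq_succ] at h₃
      have h₃ : ∀ i, ∃ j, p j = c' i := by
        intro i
        have : c' i ∈ range p := by
          rw [h₂]
          change (G.spanning A).Joined (y 0) (G.src (c i))
          rw [(hc.2 i).1]; exact key i
        exact this
      choose j hj using h₃
      have h₄ : ∀ i, (j (i + 1) : ℕ) = j i + 1 := by
        intro i
        have h₅ : x (j (i + 1)).castSucc = x (j i).succ := by
          rw [← (hp.2 _).1, ← (hp.2 _).2, hj, hj]
          change G.src (c (i + 1)) = G.tgt (c i)
          rw [(hc.2 _).1, (hc.2 _).2]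
        have h₆ := congrArg Fin.val (hp.1 h₅)
        simpa using h₆
      obtain ⟨i, hi⟩ := Finite.exists_max j
      have h₇ : (j (i + 1) : ℕ) ≤ j i := hi (i + 1)
      have h₈ := h₄ i
      omega
  · rintro ⟨hs, ht, hcyc⟩ v
    let H := G.spanning A
    let P : ℕ → Prop := fun n => ∃ (x : Fin (n + 1) → V) (p : Fin n → A),
      H.IsSimplePath x p ∧ ∀ i, H.Joined v (x i)
    have hP0 : P 0 := ⟨fun _ => v, Fin.elim0, ⟨fun a b _ => Fin.ext (by omega),
      fun i => i.elim0⟩, fun _ => SimpleGraph.Reachable.refl _⟩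
    have hbd : ∀ n, P n → n ≤ Nat.card V := by
      rintro n ⟨x, p, hx, -⟩
      have := Nat.card_le_card_of_injective x hx.1
      simp at this
      omega
    classical
    have hmax : ∃ n, P n ∧ ¬ P (n + 1) := by
      by_contra hcon
      push Not at hcon
      have hall : ∀ n, P n := fun n => Nat.rec hP0 (fun n ih => hcon n ih) n
      have := hbd _ (hall (Nat.card V + 1))
      omega
    obtain ⟨n, ⟨x, p, hp, hj⟩, hno⟩ := hmax
    -- an edge that starts on the path belongs to it
    have hsrc : ∀ (e : A) (i : Fin (n + 1)), H.src e = x i → e ∈ range p := by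
      intro e i hi
      induction i using Fin.lastCases with
      | cast i =>
        refine ⟨i, Subtype.ext (hs (p i).2 e.2 ?_)⟩
        exact (hp.2 i).1.trans hi.symm
      | last =>
        exfalso
        by_cases hmem : H.tgt e ∈ range x
        · obtain ⟨k, hk⟩ := hmem
          induction k using Fin.cases with
          | zero =>
            let c : Fin (n + 1) → E := Fin.snoc (α := fun _ => E) (fun i => (p i : E)) (e : E)
            refine hcyc n x c ⟨hp.1, fun l => ?_⟩ ?_
            · induction l using Fin.lastCases with
              | last =>
                simp only [c, Fin.snoc_last, Fin.last_add_one]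
                exact ⟨hi, hk.symm⟩
              | cast l =>
                simp only [c, Fin.snoc_castSucc, Fin.coeSucc_eq_succ]
                exact hp.2 l
            · rintro _ ⟨l, rfl⟩
              induction l using Fin.lastCases with
              | last => simp [c]
              | cast l => simp [c]
          | succ k =>
            have h₁ : p k = e := Subtype.ext (ht (p k).2 e.2 ((hp.2 k).2.trans hk))
            have h₂ : x k.castSucc = x (Fin.last n) := by
              rw [← (hp.2 k).1, h₁]; exact hi
            exact (Fin.castSucc_lt_last k).ne (hp.1 h₂)
        · apply hno
          refine ⟨Fin.snoc (α := fun _ => V) x (H.tgt e), Fin.snoc (α := fun _ => A) p e,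
            ⟨?_, ?_⟩, ?_⟩
          · exact Fin.snoc_injective_of_injective hp.1 hmem
          · intro l
            induction l using Fin.lastCases with
            | last =>
              rw [Fin.snoc_last, Fin.snoc_castSucc, Fin.succ_last, Fin.snoc_last]
              exact ⟨hi, rfl⟩
            | cast l =>
              rw [Fin.snoc_castSucc, Fin.snoc_castSucc, Fin.succ_castSucc, Fin.snoc_castSucc]
              exact hp.2 l
          · intro l
            induction l using Fin.lastCases with
            | last =>
              rw [Fin.snoc_last]
              refine SimpleGraph.Reachable.trans (hj (Fin.last n)) ?_
              rw [← hi]; exact H.joined_src_tgt e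
            | cast l => rw [Fin.snoc_castSucc]; exact hj l
    have htgt : ∀ (e : A) (i : Fin (n + 1)), H.tgt e = x i → e ∈ range p := by
      intro e i hi
      induction i using Fin.cases with
      | succ i =>
        refine ⟨i, Subtype.ext (ht (p i).2 e.2 ?_)⟩
        exact (hp.2 i).2.trans hi.symm
      | zero =>
        by_cases hmem : H.src e ∈ range x
        · obtain ⟨k, hk⟩ := hmem
          exact hsrc e k hk.symm
        · exfalso
          apply hno
          refine ⟨Fin.cons (α := fun _ => V) (H.src e) x, Fin.cons (α := fun _ => A) e p,
            ⟨?_, ?_⟩, ?_⟩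
          · exact Fin.cons_injective_of_injective hmem hp.1
          · intro l
            induction l using Fin.cases with
            | zero =>
              rw [Fin.cons_zero, Fin.castSucc_zero, Fin.cons_zero, Fin.cons_succ]
              exact ⟨rfl, hi⟩
            | succ l =>
              rw [Fin.cons_succ, Fin.cons_succ, ← Fin.succ_castSucc, Fin.cons_succ]
              exact hp.2 l
          · intro l
            induction l using Fin.cases with
            | zero =>
              rw [Fin.cons_zero]
              refine SimpleGraph.Reachable.trans (hj 0) ?_
              rw [← hi]; exact (H.joined_src_tgt e).symm
            | succ l => rw [Fin.cons_succ]; exact hj l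
    have hpx : ∀ e ∈ range p, H.src e ∈ range x ∧ H.tgt e ∈ range x := by
      rintro _ ⟨i, rfl⟩
      exact ⟨⟨_, (hp.2 i).1.symm⟩, ⟨_, (hp.2 i).2.symm⟩⟩
    have hclosed : ∀ a b, H.Joined a b → a ∈ range x → b ∈ range x := by
      rintro a b ⟨w⟩ ha
      induction w with
      | nil => exact ha
      | cons hadj _ ih =>
        apply ih
        obtain ⟨i, rfl⟩ := ha
        obtain ⟨-, ⟨e, h₁, h₂⟩ | ⟨e, h₁, h₂⟩⟩ := (SimpleGraph.fromRel_adj _ _ _).1 hadj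
        · rw [← h₂]; exact (hpx e (hsrc e i h₁)).2
        · rw [← h₁]; exact (hpx e (htgt e i h₂)).1
    have hxv : range x = {w | H.Joined v w} := by
      ext w
      constructor
      · rintro ⟨i, rfl⟩; exact hj i
      · intro hw
        exact hclosed (x 0) w (SimpleGraph.Reachable.trans (hj 0).symm hw) ⟨0, rfl⟩
    refine ⟨n, x, p, hp, hxv, ?_⟩
    ext e
    constructor
    · intro he
      have := (hpx e he).1
      rw [hxv] at this
      exact this
    · intro he
      have : H.src e ∈ range x := by rw [hxv]; exact he
      obtain ⟨i, hi⟩ := this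
      exact hsrc e i hi.symm

/-- In an MP-digraph no edge shares its source with one edge and its target with another one. -/
theorem IsMP.not_zigzag {G : EDigraph V E} (hG : G.IsMP) {e f g : E}
    (he : G.src e ≠ G.tgt e) (hf : G.src f ≠ G.tgt f) (hg : G.src g ≠ G.tgt g)
    (hef : e ≠ f) (hfg : f ≠ g) (h₁ : G.tgt e = G.tgt f) (h₂ : G.src f = G.src g) : False := by
  have h₃ : G.src e ≠ G.src f := fun h => hef (G.eq_of_ends e f he h h₁)
  have h₄ : G.tgt f ≠ G.tgt g := fun h => hfg (G.eq_of_ends f g hf h₂ h)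
  have a₁ : G.Adj (G.src e) (G.tgt f) := ⟨e, rfl, h₁⟩
  have a₂ : G.Adj (G.src f) (G.tgt f) := ⟨f, rfl, rfl⟩
  have a₃ : G.Adj (G.src f) (G.tgt g) := ⟨g, h₂.symm, rfl⟩
  rw [h₁] at he
  rw [← h₂] at hg
  by_cases h₅ : G.src e = G.tgt g
  · apply hG.no_triangle.1
    refine ⟨![G.src e, G.src f, G.tgt f], ?_, ?_⟩
    · intro i j hij
      fin_cases i <;> fin_cases j <;> simp_all
    · rw [← h₅] at a₃
      exact ⟨a₃, a₁, a₂⟩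
  · apply hG.no_alternating.1
    refine ⟨![G.src e, G.tgt f, G.src f, G.tgt g], ?_, a₁, a₂, a₃⟩
    intro i j hij
    fin_cases i <;> fin_cases j <;> simp_all

/-- Two edges have the same source or the same target. -/
def Conflict (G : EDigraph V E) (e f : E) : Prop := G.src e = G.src f ∨ G.tgt e = G.tgt f

theorem IsMP.conflict_trans {G : EDigraph V E} (hG : G.IsMP) {e f g : E}
    (he : G.src e ≠ G.tgt e) (hf : G.src f ≠ G.tgt f) (hg : G.src g ≠ G.tgt g)
    (h₁ : G.Conflict e f) (h₂ : G.Conflict f g) : G.Conflict e g := by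
  by_cases hef : e = f
  · rwa [hef]
  by_cases hfg : f = g
  · rwa [← hfg]
  rcases h₁ with h₁ | h₁ <;> rcases h₂ with h₂ | h₂
  · exact Or.inl (h₁.trans h₂)
  · exact (hG.not_zigzag hg hf he (Ne.symm hfg) (Ne.symm hef) h₂.symm h₁.symm).elim
  · exact (hG.not_zigzag he hf hg hef hfg h₁ h₂).elim
  · exact Or.inr (h₁.trans h₂)

/-- In a cycle that is a connected component, an edge conflicts only with itself. -/
theorem IsMP.cycle_conflict {G : EDigraph V E} (hG : G.IsMP) {n : ℕ} {x : Fin (n + 1) → V}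
    {c : Fin (n + 1) → E} (hn : 1 ≤ n) (hc : G.IsOrientedCycle x c) {e f : E} (he : e ∈ range c)
    (h : G.Conflict e f) : e = f := by
  have h₂ := (hG.cycle_component n x c hn hc).2
  have hf : f ∈ range c := by
    rw [h₂] at he ⊢
    change G.Joined _ _ at he
    change G.Joined _ _
    rcases h with h | h
    · rwa [← h]
    · refine SimpleGraph.Reachable.trans he
        (SimpleGraph.Reachable.trans (G.joined_src_tgt e) ?_)
      rw [h]; exact (G.joined_src_tgt f).symm
  obtain ⟨i, rfl⟩ := he
  obtain ⟨j, rfl⟩ := hf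
  rcases h with h | h
  · rw [(hc.2 _).1, (hc.2 _).1] at h
    rw [hc.1 h]
  · rw [(hc.2 _).2, (hc.2 _).2] at h
    rw [add_right_cancel (hc.1 h)]

theorem IsMultipath.src_ne_tgt [Finite V] {G : EDigraph V E} {A : Set E} (hA : G.IsMultipath A)
    {e : E} (he : e ∈ A) : G.src e ≠ G.tgt e := by
  intro h
  refine ((G.isMultipath_iff A).1 hA).2.2 0 (fun _ => G.src e) (fun _ => e)
    ⟨fun a b _ => Fin.ext (by omega), fun _ => ⟨rfl, h.symm⟩⟩ ?_
  rintro _ ⟨_, rfl⟩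
  exact he

theorem IsMultipath.eq_of_conflict [Finite V] {G : EDigraph V E} {A : Set E}
    (hA : G.IsMultipath A) {e f : E} (he : e ∈ A) (hf : f ∈ A) (h : G.Conflict e f) : e = f := by
  obtain ⟨h₁, h₂, -⟩ := (G.isMultipath_iff A).1 hA
  exact h.elim (h₁ he hf) (h₂ he hf)

theorem isMultipath_empty [Finite V] (G : EDigraph V E) : G.IsMultipath ∅ :=
  (G.isMultipath_iff ∅).2 ⟨injOn_empty _, injOn_empty _, fun _ _ _ _ h => h ⟨0, rfl⟩⟩

theorem IsMultipath.subset [Finite V] {G : EDigraph V E} {A B : Set E} (hB : G.IsMultipath B)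
    (h : A ⊆ B) : G.IsMultipath A := by
  obtain ⟨h₁, h₂, h₃⟩ := (G.isMultipath_iff B).1 hB
  exact (G.isMultipath_iff A).2 ⟨h₁.mono h, h₂.mono h,
    fun n x c hc hcA => h₃ n x c hc (hcA.trans h)⟩

theorem IsMP.augment [Finite V] [Finite E] {G : EDigraph V E} (hG : G.IsMP) {A B : Set E}
    (hA : G.IsMultipath A) (hB : G.IsMultipath B) (hlt : A.ncard < B.ncard) :
    ∃ e ∈ B, e ∉ A ∧ G.IsMultipath (insert e A) := by
  by_contra hcon
  push Not at hcon
  -- `f` is an edge of `A \ B` that blocks the edge `e` of `B \ A`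
  have key : ∀ e : (B \ A : Set E), ∃ f : (A \ B : Set E), G.Conflict e f ∨
      ∃ (n : ℕ) (x : Fin (n + 1) → V) (c : Fin (n + 1) → E), 1 ≤ n ∧ G.IsOrientedCycle x c ∧
        (e : E) ∈ range c ∧ (f : E) ∈ range c ∧ range c ⊆ insert (e : E) A := by
    rintro ⟨e, heB, heA⟩
    by_cases hconf : ∃ f ∈ A, G.Conflict e f
    · obtain ⟨f, hf, h⟩ := hconf
      refine ⟨⟨f, hf, fun hfB => heA ?_⟩, Or.inl h⟩
      rw [hB.eq_of_conflict heB hfB h]; exact hf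
    · have hno := hcon e heB heA
      rw [isMultipath_iff] at hno
      obtain ⟨h₁, h₂, h₃⟩ := (G.isMultipath_iff A).1 hA
      push Not at hconf
      have i₁ : InjOn G.src (insert e A) := by
        rw [injOn_insert heA]
        exact ⟨h₁, fun ⟨f, hf, h⟩ => hconf f hf (Or.inl h.symm)⟩
      have i₂ : InjOn G.tgt (insert e A) := by
        rw [injOn_insert heA]
        exact ⟨h₂, fun ⟨f, hf, h⟩ => hconf f hf (Or.inr h.symm)⟩
      have h₄ : ∃ (n : ℕ) (x : Fin (n + 1) → V) (c : Fin (n + 1) → E), G.IsOrientedCycle x c ∧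
          range c ⊆ insert e A := by
        by_contra h
        push Not at h
        exact hno ⟨i₁, i₂, h⟩
      obtain ⟨n, x, c, hc, hsub⟩ := h₄
      have hec : e ∈ range c := by
        by_contra h
        refine h₃ n x c hc fun f hf => (hsub hf).resolve_left ?_
        rintro rfl
        exact h hf
      have hn : 1 ≤ n := by
        by_contra h
        have : n = 0 := by omega
        subst this
        obtain ⟨i, hi⟩ := hec
        apply hB.src_ne_tgt heB
        rw [← hi, (hc.2 i).1, (hc.2 i).2, show i + 1 = i from Fin.ext (by omega)]
      have h₅ : ¬ range c ⊆ B := ((G.isMultipath_iff B).1 hB).2.2 n x c hc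
      obtain ⟨f, hfc, hfB⟩ := not_subset.1 h₅
      refine ⟨⟨f, (hsub hfc).resolve_left ?_, hfB⟩,
        Or.inr ⟨n, x, c, hn, hc, hec, hfc, hsub⟩⟩
      rintro rfl
      exact hfB heB
  choose φ hφ using key
  have hinj : Injective φ := by
    intro e e' hee
    have hf : (φ e : E) = φ e' := congrArg Subtype.val hee
    have hc' : ∀ {a b : E}, G.Conflict a b → G.Conflict b a := fun h =>
      h.imp Eq.symm Eq.symm
    have hcross : ∀ {a : (B \ A : Set E)} {b : (A \ B : Set E)} {n : ℕ} {x : Fin (n + 1) → V}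
        {c : Fin (n + 1) → E}, 1 ≤ n → G.IsOrientedCycle x c → (b : E) ∈ range c →
        ¬ G.Conflict a b := by
      intro a b n x c hn hc hb h
      apply a.2.2
      rw [← hG.cycle_conflict hn hc hb (hc' h)]
      exact b.2.1
    rcases hφ e with h | ⟨n, x, c, hn, hc, hec, hfc, hsub⟩
    · rcases hφ e' with h' | ⟨n, x, c, hn, hc, hec, hfc, hsub⟩
      · rw [← hf] at h'
        exact Subtype.ext (hB.eq_of_conflict e.2.1 e'.2.1 (hG.conflict_trans
          (hB.src_ne_tgt e.2.1) (hA.src_ne_tgt (φ e).2.1) (hB.src_ne_tgt e'.2.1) h (hc' h')))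
      · rw [← hf] at hfc
        exact (hcross hn hc hfc h).elim
    · rcases hφ e' with h' | ⟨n', x', c', hn', hc'', hec', hfc', hsub'⟩
      · rw [← hf] at h'
        exact (hcross hn hc hfc h').elim
      · have h₁ := (hG.cycle_component n x c hn hc).2
        have h₂ := (hG.cycle_component n' x' c' hn' hc'').2
        rw [← hf] at hfc'
        have : (e : E) ∈ range c' := by
          rw [h₁] at hec hfc
          rw [h₂] at hfc' ⊢
          exact SimpleGraph.Reachable.trans hfc'
            (SimpleGraph.Reachable.trans (SimpleGraph.Reachable.symm hfc) hec)
        exact Subtype.ext ((hsub' this).resolve_right e.2.2)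
  have hle : (B \ A).ncard ≤ (A \ B).ncard := Nat.card_le_card_of_injective φ hinj
  have h₁ := ncard_inter_add_ncard_sdiff_eq_ncard A B
  have h₂ := ncard_inter_add_ncard_sdiff_eq_ncard B A
  rw [inter_comm] at h₂
  omega

/-- The multipath matroid of a finite MP-digraph: the ground set is the set of all edges, and the
independent sets are the multipaths. -/
def multipathMatroid [Finite V] [Finite E] (G : EDigraph V E) (hG : G.IsMP) : Matroid E :=
  (IndepMatroid.ofFinite (E := univ) finite_univ G.IsMultipath G.isMultipath_empty
    (fun _ _ hB h => hB.subset h) (fun _ _ hA hB h => hG.augment hA hB h)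
    (fun _ _ => subset_univ _)).matroid

theorem multipathMatroid_ground [Finite V] [Finite E] (G : EDigraph V E) (hG : G.IsMP) :
    (G.multipathMatroid hG).E = univ := rfl

theorem multipathMatroid_indep [Finite V] [Finite E] (G : EDigraph V E) (hG : G.IsMP)
    (A : Set E) : (G.multipathMatroid hG).Indep A ↔ G.IsMultipath A := Iff.rfl

end EDigraph

/-- The rank of a set in a matroid on a finite type, as a natural number. -/
noncomputable def matroidRank {α : Type*} (M : Matroid α) (A : Set α) : ℕ := (M.eRk A).toNat

/-- The Tutte polynomial of a matroid on a finite type, in the variables `X 0` and `X 1`. (Both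
exponents are differences of natural numbers that are never negative.) -/
noncomputable def tuttePolynomial {α : Type*} [Finite α] (M : Matroid α) : MvPolynomial (Fin 2) ℤ :=
  ∑ A ∈ (Set.toFinite M.E).toFinset.powerset,
    (MvPolynomial.X 0 - 1) ^ (matroidRank M M.E - matroidRank M (A : Set α)) *
      (MvPolynomial.X 1 - 1) ^ (A.card - matroidRank M (A : Set α))

/-! By (MP2), a connected loopless MP-digraph other than a coherently oriented cycle has no oriented
cycle at all, so a multipath is just a set of edges no two of which conflict, that is, share a
source or share a target. By (MP1), conflict is an equivalence relation. So the independent sets are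
the partial transversals of the conflict classes, and `M_G` is a direct sum of uniform matroids of
rank one, one for each class. Each summand on `n` elements has Tutte polynomial `x + y + ... + y ^
(n - 1)`, hence `T(x, 0) = x ^ r`, where `r` is the number of classes (`IsMP.matroidRank_eq`,
`eval_tuttePolynomial_of_matroidRank_eq`). The formal evaluation avoids direct sums and computes the
defining sum by inclusion-exclusion.

On the other side, a colouring of a tree by a cyclic group amounts to a colour at a root and
arbitrary differences along the edges. It is flowing exactly when the differences are nonzero and
constant on conflict classes, which leaves `k * (k - 1) ^ r(S)` colourings (`IsTree.numFlowing_eq`).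
With `r(S) = r(G)` both sides of the relation are `k * (1 - k) ^ r(G)`. -/

namespace EDigraph

variable {V E : Type*}

/-! ### Acyclicity, conflict classes and rank -/

/-- A connected loopless MP-digraph that is not a coherently oriented cycle has no oriented
cycles. -/
theorem IsMP.not_isOrientedCycle {G : EDigraph V E} (hG : G.IsMP) (hconn : G.Connected)
    (hloop : G.Loopless) (hcyc : ¬ G.IsCoherentlyOrientedCycle) {n : ℕ} (x : Fin (n + 1) → V)
    (c : Fin (n + 1) → E) : ¬ G.IsOrientedCycle x c := by
  intro h
  rcases Nat.eq_zero_or_pos n with rfl | hn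
  · apply hloop (c 0)
    rw [(h.2 0).1, (h.2 0).2, show (0 : Fin 1) + 1 = 0 from rfl]
  -- By (MP2) the cycle is a whole component, which by connectedness is all of `G`.
  · obtain ⟨h₁, h₂⟩ := hG.cycle_component n x c hn h
    refine hcyc ⟨n, x, c, h, ?_, ?_⟩
    · rw [h₁]
      exact eq_univ_of_forall fun w => hconn.preconnected _ w
    · rw [h₂]
      exact eq_univ_of_forall fun e => hconn.preconnected _ (G.src e)

/-- In a loopless MP-digraph, having a common source or a common target is an equivalence relation
on the edges. -/
def IsMP.conflictSetoid {G : EDigraph V E} (hG : G.IsMP) (hloop : G.Loopless) : Setoid E where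
  r := G.Conflict
  iseqv := ⟨fun _ => Or.inl rfl, fun h => h.imp Eq.symm Eq.symm,
    fun h₁ h₂ => hG.conflict_trans (hloop _) (hloop _) (hloop _) h₁ h₂⟩

/-- The conflict class of an edge. -/
def IsMP.conflictClass {G : EDigraph V E} (hG : G.IsMP) (hloop : G.Loopless) (e : E) :
    Quotient (hG.conflictSetoid hloop) := Quotient.mk _ e

theorem IsMP.conflictClass_eq_iff {G : EDigraph V E} (hG : G.IsMP) (hloop : G.Loopless) {e f : E} :
    hG.conflictClass hloop e = hG.conflictClass hloop f ↔ G.Conflict e f :=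
  Quotient.eq

theorem IsMP.conflictClass_surjective {G : EDigraph V E} (hG : G.IsMP) (hloop : G.Loopless) :
    Surjective (hG.conflictClass hloop) := Quotient.mk_surjective

/-- Without oriented cycles, the multipaths are the partial transversals of the conflict classes. -/
theorem IsMP.isMultipath_iff_injOn [Finite V] {G : EDigraph V E} (hG : G.IsMP)
    (hloop : G.Loopless)
    (hac : ∀ (n : ℕ) (x : Fin (n + 1) → V) (c : Fin (n + 1) → E), ¬ G.IsOrientedCycle x c)
    (A : Set E) : G.IsMultipath A ↔ InjOn (hG.conflictClass hloop) A := by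
  constructor
  · intro hA e he f hf h
    exact hA.eq_of_conflict he hf ((hG.conflictClass_eq_iff hloop).1 h)
  · intro h
    refine (G.isMultipath_iff A).2 ⟨fun e he f hf hef => ?_, fun e he f hf hef => ?_,
      fun n x c hc => (hac n x c hc).elim⟩
    · exact h he hf ((hG.conflictClass_eq_iff hloop).2 (Or.inl hef))
    · exact h he hf ((hG.conflictClass_eq_iff hloop).2 (Or.inr hef))

/-- Without oriented cycles, the rank of a set of edges is the number of conflict classes that it
meets. -/
theorem IsMP.matroidRank_eq [Finite V] [Finite E] {G : EDigraph V E} (hG : G.IsMP)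
    (hloop : G.Loopless)
    (hac : ∀ (n : ℕ) (x : Fin (n + 1) → V) (c : Fin (n + 1) → E), ¬ G.IsOrientedCycle x c)
    (A : Set E) :
    matroidRank (G.multipathMatroid hG) A = (hG.conflictClass hloop '' A).ncard := by
  -- `I` picks one edge from each class that `A` meets. It is a basis of `A`, since any further edge
  -- of `A` repeats a class.
  obtain ⟨I, hIA, hI⟩ := (surjOn_image (hG.conflictClass hloop) A).exists_bijOn_subset
  have hind : ∀ J, (G.multipathMatroid hG).Indep J ↔ InjOn (hG.conflictClass hloop) J := fun J =>
    (G.multipathMatroid_indep hG J).trans (hG.isMultipath_iff_injOn hloop hac J)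
  have hbasis : (G.multipathMatroid hG).IsBasis I A := by
    refine ((hind I).2 hI.injOn).isBasis_of_forall_insert hIA fun e he => ?_
    rw [Matroid.dep_iff, hind]
    refine ⟨fun hinj => ?_, by rw [multipathMatroid_ground]; exact subset_univ _⟩
    obtain ⟨f, hf, hfe⟩ := hI.surjOn (mem_image_of_mem _ he.1)
    apply he.2
    rw [← hinj (mem_insert_of_mem _ hf) (mem_insert _ _) hfe]
    exact hf
  rw [matroidRank, ← hbasis.encard_eq_eRk, ← hI.image_eq, hI.injOn.ncard_image]
  rfl

/-! ### Trees and their flowing colourings -/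

/-- A digraph whose underlying multigraph is a tree has one edge less than it has vertices. -/
theorem IsTree.card_add_one [Finite V] [Finite E] {H : EDigraph V E} (hH : H.IsTree) :
    Nat.card E + 1 = Nat.card V := by
  classical
  have := Fintype.ofFinite V
  have := Fintype.ofFinite E
  obtain ⟨hloop, hinj, htree⟩ := hH
  have hcard : Nat.card E = Nat.card H.underlying.edgeSet := by
    have hmem : ∀ e, s(H.src e, H.tgt e) ∈ H.underlying.edgeSet := fun e =>
      (SimpleGraph.fromRel_adj _ _ _).2 ⟨hloop e, Or.inl ⟨e, rfl, rfl⟩⟩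
    refine Nat.card_eq_of_bijective (fun e => ⟨s(H.src e, H.tgt e), hmem e⟩)
      ⟨fun e f h => hinj (congrArg Subtype.val h), ?_⟩
    rintro ⟨z, hz⟩
    induction z with
    | _ v w =>
      obtain ⟨-, ⟨e, rfl, rfl⟩ | ⟨e, rfl, rfl⟩⟩ := (SimpleGraph.fromRel_adj _ _ _).1 hz
      · exact ⟨e, rfl⟩
      · exact ⟨e, Subtype.ext Sym2.eq_swap⟩
  rw [hcard, Nat.card_eq_fintype_card, Nat.card_eq_fintype_card, ← htree.card_edgeFinset,
    SimpleGraph.edgeFinset_card]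

/-- On a tree, a function to an abelian group is determined by its value at a vertex and its
differences along the edges, and these can be prescribed. -/
theorem IsTree.bijective_differences [Finite V] [Finite E] {H : EDigraph V E} (hH : H.IsTree)
    (v₀ : V) (M : Type*) [AddCommGroup M] [Finite M] :
    Bijective fun c : V → M => (c v₀, fun e => c (H.tgt e) - c (H.src e)) := by
  classical
  have := Fintype.ofFinite V
  have := Fintype.ofFinite E
  have := Fintype.ofFinite M
  -- Only injectivity needs an argument, by propagation along walks from `v₀`; the cardinalities
  -- agree because `|V| = |E| + 1`.
  rw [Fintype.bijective_iff_injective_and_card]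
  constructor
  · intro c d hcd
    obtain ⟨h₀, h₁⟩ := Prod.mk.inj hcd
    have hadj : ∀ v w, H.underlying.Adj v w → c v = d v → c w = d w := by
      intro v w hvw hv
      obtain ⟨-, ⟨e, rfl, rfl⟩ | ⟨e, rfl, rfl⟩⟩ := (SimpleGraph.fromRel_adj _ _ _).1 hvw
      · have := congrFun h₁ e
        simp only [hv] at this
        exact sub_left_injective this
      · have := congrFun h₁ e
        simp only [hv] at this
        exact sub_right_injective this
    have hwalk : ∀ v w (_ : H.underlying.Walk v w), c v = d v → c w = d w := by
      intro v w p
      induction p with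
      | nil => exact id
      | cons h _ ih => exact fun hv => ih (hadj _ _ h hv)
    funext w
    obtain ⟨p⟩ := hH.2.2.connected.preconnected v₀ w
    exact hwalk _ _ p h₀
  · have := hH.card_add_one
    rw [Nat.card_eq_fintype_card, Nat.card_eq_fintype_card] at this
    rw [Fintype.card_prod, Fintype.card_fun, Fintype.card_fun, ← this, pow_succ']

/-- The number of flowing colourings of a tree. -/
theorem IsTree.numFlowing_eq [Finite V] [Finite E] {H : EDigraph V E} (hH : H.IsTree)
    (hMP : H.IsMP) (k : ℕ) :
    H.numFlowing k = k * (k - 1) ^ Nat.card (Quotient (hMP.conflictSetoid hH.1)) := by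
  classical
  obtain ⟨v₀⟩ := hH.2.2.connected.nonempty
  rcases k with _ | k
  -- `Fin 0` carries no group structure, so this case stands apart; the factor `k = 0` makes the
  -- truncated `k - 1` harmless.
  · have : IsEmpty {c : V → Fin 0 // H.IsFlowing c} := ⟨fun c => (c.1 v₀).elim0⟩
    rw [numFlowing, Nat.card_of_isEmpty, zero_mul]
  obtain ⟨hinj, hsurj⟩ := hH.bijective_differences v₀ (Fin (k + 1))
  -- If two edges share one end, the flowing condition equates the colours of their other ends, so
  -- the differences agree.
  have hconst : ∀ c : V → Fin (k + 1), H.IsFlowing c → ∀ e f, H.Conflict e f →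
      c (H.tgt e) - c (H.src e) = c (H.tgt f) - c (H.src f) := by
    rintro c ⟨-, h₂, h₃⟩ e f (h | h)
    · rw [h₃ e f h, h]
    · rw [h₂ e f h, h]
  -- The root colour together with the difference on each class, nonzero because the colouring is
  -- proper.
  let Φ : {c : V → Fin (k + 1) // H.IsFlowing c} →
      Fin (k + 1) × (Quotient (hMP.conflictSetoid hH.1) → {a : Fin (k + 1) // a ≠ 0}) := fun c =>
    (c.1 v₀, Quotient.lift
      (fun e => ⟨c.1 (H.tgt e) - c.1 (H.src e), sub_ne_zero.2 (c.2.1 e).symm⟩)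
      (fun e f h => Subtype.ext (hconst c.1 c.2 e f h)))
  have hΦ : Bijective Φ := by
    constructor
    · intro c d hcd
      obtain ⟨h₀, h₁⟩ := Prod.mk.inj hcd
      refine Subtype.ext (hinj (Prod.ext h₀ (funext fun e => ?_)))
      exact congrArg Subtype.val (congrFun h₁ (Quotient.mk _ e))
    · rintro ⟨a, g⟩
      obtain ⟨c, hc⟩ := hsurj (a, fun e => (g (hMP.conflictClass hH.1 e)).1)
      obtain ⟨h₀, h₁⟩ := Prod.mk.inj hc
      have hd : ∀ e, c (H.tgt e) - c (H.src e) = (g (hMP.conflictClass hH.1 e)).1 := congrFun h₁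
      have hcongr : ∀ e f, H.Conflict e f →
          c (H.tgt e) - c (H.src e) = c (H.tgt f) - c (H.src f) := fun e f h => by
        rw [hd, hd, (hMP.conflictClass_eq_iff hH.1).2 h]
      -- The converse to `hconst`: equal differences and equal colours at one end force equal
      -- colours at the other.
      refine ⟨⟨c, fun e h => ?_, fun e f h => ?_, fun e f h => ?_⟩, Prod.ext h₀ (funext fun z => ?_)⟩
      · exact (g (hMP.conflictClass hH.1 e)).2 (by rw [← hd, h, sub_self])
      · have := hcongr e f (Or.inr h)
        rw [h] at this
        exact sub_right_injective this
      · have := hcongr e f (Or.inl h)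
        rw [h] at this
        exact sub_left_injective this
      · induction z using Quotient.inductionOn with
        | h e => exact Subtype.ext (hd e)
  rw [numFlowing, Nat.card_eq_of_bijective Φ hΦ, Nat.card_prod, Nat.card_fun]
  simp [Fintype.card_subtype_compl]

end EDigraph

/-! ### Evaluation of the Tutte polynomial -/

/-- The signed count, over all subsets `A` of `E`, of the pairs of `A` and a `k`-weighted choice
outside of the image of `A` under a surjection. -/
theorem sum_neg_one_pow_card_mul_pow {E Q R : Type*} [Fintype E] [Fintype Q] [DecidableEq Q]
    [CommRing R] (q : E → Q) (hq : Surjective q) (a : R) :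
    ∑ A : Finset E, (-1) ^ A.card * a ^ (Fintype.card Q - (A.image q).card) =
      (a - 1) ^ Fintype.card Q := by
  classical
  -- Expand `a = (a - 1) + 1` over the complement of `q(A)`: the sum runs over the sets `C` disjoint
  -- from `q(A)`, equivalently those for which `A` avoids the preimage of `C`. After exchanging the
  -- sums, the inner one is an alternating sum over all subsets of a fixed set of edges, which
  -- vanishes unless that set is empty.
  have h₁ : ∀ A : Finset E, a ^ (Fintype.card Q - (A.image q).card) =
      ∑ C : Finset Q, if A ⊆ Finset.univ.filter (fun e => q e ∉ C) then (a - 1) ^ C.card else 0 := by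
    intro A
    have h := Finset.sum_pow_mul_eq_add_pow (a - 1) 1 (A.image q)ᶜ
    rw [sub_add_cancel, Finset.card_compl] at h
    rw [← h, ← Finset.sum_filter]
    refine Finset.sum_congr ?_ fun C _ => by rw [one_pow, mul_one]
    ext C
    simp only [Finset.mem_powerset, Finset.mem_filter, Finset.mem_univ, true_and,
      Finset.subset_iff, Finset.mem_compl, Finset.mem_image, not_exists, not_and]
    exact ⟨fun h e he hC => h hC e he rfl, fun h z hz e he hez => h he (hez ▸ hz)⟩
  simp_rw [h₁, Finset.mul_sum]
  rw [Finset.sum_comm, Finset.sum_eq_single Finset.univ]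
  · rw [Finset.sum_eq_single ∅]
    · simp
    · intro A _ hA
      rw [if_neg, mul_zero]
      simpa [Finset.subset_empty] using hA
    · simp
  · intro C _ hC
    -- Surjectivity of `q` enters here: a class missing from `C` contains an edge, so only `C =
    -- univ` contributes.
    have hne : Finset.univ.filter (fun e => q e ∉ C) ≠ ∅ := by
      obtain ⟨z, hz⟩ : ∃ z, z ∉ C := by
        by_contra h
        push Not at h
        exact hC (Finset.eq_univ_of_forall h)
      obtain ⟨e, rfl⟩ := hq z
      exact Finset.ne_empty_of_mem (Finset.mem_filter.2 ⟨Finset.mem_univ e, hz⟩)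
    have h := congrArg (Int.cast : ℤ → R)
      (Finset.sum_powerset_neg_one_pow_card (x := Finset.univ.filter (fun e => q e ∉ C)))
    rw [if_neg hne] at h
    push_cast at h
    simp_rw [mul_ite, mul_zero]
    rw [← Finset.sum_filter, ← Finset.sum_mul]
    have h₂ : Finset.univ.filter (fun A => A ⊆ Finset.univ.filter (fun e => q e ∉ C)) =
        (Finset.univ.filter (fun e => q e ∉ C)).powerset := by
      ext A
      simp only [Finset.mem_filter, Finset.mem_univ, true_and, Finset.mem_powerset]
    rw [h₂, h, zero_mul]
  · simp

/-- The Tutte polynomial at `(x, 0)` of a matroid in which the rank of a set is the number of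
classes of a partition that it meets. -/
theorem eval_tuttePolynomial_of_matroidRank_eq {E Q : Type*} [Finite E] [Finite Q] (M : Matroid E)
    (hE : M.E = univ) (q : E → Q) (hq : Surjective q)
    (hM : ∀ A, matroidRank M A = (q '' A).ncard) (x : ℤ) :
    MvPolynomial.eval ![x, 0] (tuttePolynomial M) = x ^ Nat.card Q := by
  classical
  have := Fintype.ofFinite E
  have := Fintype.ofFinite Q
  have hr : matroidRank M M.E = Fintype.card Q := by
    rw [hM, hE, image_univ, hq.range_eq, ncard_univ, Nat.card_eq_fintype_card]
  have hrA : ∀ A : Finset E, matroidRank M A = (A.image q).card := fun A => by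
    rw [hM, ← Finset.coe_image, ncard_coe_finset]
  have hp : (Set.toFinite M.E).toFinset.powerset = (Finset.univ : Finset (Finset E)) := by
    ext A
    simp [hE]
  -- Turning `x - 1` into `1 - x` makes the total sign exponent `|Q| + |A| - 2 |q(A)|`, and the even
  -- part drops out. The sum then has the form of the preceding lemma with `a = 1 - x`.
  have hterm : ∀ A : Finset E,
      (x - 1) ^ (Fintype.card Q - (A.image q).card) * (-1) ^ (A.card - (A.image q).card) =
        (-1) ^ Fintype.card Q *
          ((-1) ^ A.card * (1 - x) ^ (Fintype.card Q - (A.image q).card)) := by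
    intro A
    obtain ⟨m, hm⟩ := Nat.exists_eq_add_of_le (Finset.card_image_le (s := A) (f := q))
    obtain ⟨l, hl⟩ := Nat.exists_eq_add_of_le (Finset.card_le_univ (A.image q))
    rw [hm, hl, Nat.add_sub_cancel_left, Nat.add_sub_cancel_left, ← neg_sub 1 x, neg_pow (1 - x),
      pow_add, pow_add]
    have h := Even.neg_one_pow (α := ℤ) (Even.add_self (A.image q).card)
    rw [pow_add] at h
    linear_combination (-(-1) ^ l * (-1) ^ m * (1 - x) ^ l) * h
  rw [tuttePolynomial, hp, map_sum, Nat.card_eq_fintype_card]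
  simp only [map_mul, map_pow, map_sub, MvPolynomial.eval_X, map_one, Matrix.cons_val_zero,
    Matrix.cons_val_one, hr, hrA, zero_sub]
  simp_rw [hterm]
  -- What remains is `(-1) ^ |Q| * (-x) ^ |Q|`.
  rw [← Finset.mul_sum, sum_neg_one_pow_card_mul_pow q hq, ← mul_pow]
  congr 1
  ring

/-! ### Comparison of the two counts -/

theorem mainTheorem9 {V E : Type*} [Finite V] [Finite E] (G : EDigraph V E) (hMP : G.IsMP)
    (hconn : G.Connected) (hloop : G.Loopless) (hcyc : ¬ G.IsCoherentlyOrientedCycle)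
    (S : Set E) (hS : (G.spanning S).IsTree)
    (hrank : matroidRank ((G.spanning S).multipathMatroid (hMP.spanning S)) univ =
      matroidRank (G.multipathMatroid hMP) univ) (k : ℕ) :
    (k : ℤ) * MvPolynomial.eval ![1 - (k : ℤ), 0] (tuttePolynomial (G.multipathMatroid hMP)) =
      (-1) ^ matroidRank (G.multipathMatroid hMP) univ * ((G.spanning S).numFlowing k : ℤ) := by
  have hac : ∀ (n : ℕ) (x : Fin (n + 1) → V) (c : Fin (n + 1) → E), ¬ G.IsOrientedCycle x c :=
    fun n x c => hMP.not_isOrientedCycle hconn hloop hcyc x c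
  have hacS : ∀ (n : ℕ) (x : Fin (n + 1) → V) (c : Fin (n + 1) → S),
      ¬ (G.spanning S).IsOrientedCycle x c :=
    fun n x c h => hac n x (fun i => (c i : E)) ⟨h.1, h.2⟩
  have hsurj := hMP.conflictClass_surjective hloop
  have hr : matroidRank (G.multipathMatroid hMP) univ =
      Nat.card (Quotient (hMP.conflictSetoid hloop)) := by
    rw [hMP.matroidRank_eq hloop hac, image_univ, hsurj.range_eq, ncard_univ]
  have hrS : matroidRank ((G.spanning S).multipathMatroid (hMP.spanning S)) univ =
      Nat.card (Quotient ((hMP.spanning S).conflictSetoid hS.1)) := by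
    rw [(hMP.spanning S).matroidRank_eq hS.1 hacS, image_univ,
      ((hMP.spanning S).conflictClass_surjective hS.1).range_eq, ncard_univ]
  rw [eval_tuttePolynomial_of_matroidRank_eq _ (G.multipathMatroid_ground hMP) _ hsurj
    (hMP.matroidRank_eq hloop hac), ← hr, hS.numFlowing_eq (hMP.spanning S), ← hrS, hrank]
  -- Splitting off `k = 0` lets the natural number `k - 1` be cast to `ℤ` exactly; then `(-1) ^ r`
  -- turns `(k - 1) ^ r` into `(1 - k) ^ r`.
  rcases k with _ | k
  · simp
  · push_cast
    rw [mul_left_comm, ← mul_pow]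
    congr 2
    ring
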